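/- **Proposition 3.1.** Let $\mathrm{GL}^+(2)=\{F\in\mathbb{R}^{2\times 2} : \det F>0\}$ and let $\mathrm{PSym}(2)$ be the set of symmetric positive definite real $2\times 2$ matrices. For $F\in\mathrm{GL}^+(2)$ put $U=\sqrt{F^TF}\in\mathrm{PSym}(2)$ and $$W(F)=\|\operatorname{dev}_2\log U\|^2,\qquad \operatorname{dev}_2X=X-\tfrac12\operatorname{tr}(X)\,\mathbb 1,$$ where $\log$ is the logarithm of symmetric positive definite matrices and $\|\cdot\|$ is the Frobenius norm. Then $W$ is of class $C^2$ on $\mathrm{GL}^+(2)$, and its maximal (Legendre–Hadamard) ellipticity domain, i.e. the set of all $F\in\mathrm{GL}^+(2)$ with $$D^2W(F).(\xi\otimes\eta,\xi\otimes\eta)\ge 0\quad\text{for all }\xi,\eta\in\mathbb{R}^2,$$ is exactly the set of all $F\in\mathrm{GL}^+(2)$ whose stretch tensor $U=\sqrt{F^TF}$ lies in $$\Big\{U\in\mathrm{PSym}(2) : \|\operatorname{dev}_2\log U\|^2\le \tfrac12\Big\}.$$ Equivalently, it is the set of all $F\in\mathrm{GL}^+(2)$ whose singular values $\lambda_1,\lambda_2>0$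 satisfy $\log^2(\lambda_1/\lambda_2)\le 1$. -/

import Mathlib

open scoped Matrix

namespace Hencky

/-- `GL⁺(n)`, the set of real `n × n` matrices with positive determinant. -/
def GLplus (n : ℕ) : Set (Matrix (Fin n) (Fin n) ℝ) := {F | 0 < F.det}

/-- `PSym(n)`, the set of symmetric positive definite real `n × n` matrices. -/
def PSym (n : ℕ) : Set (Matrix (Fin n) (Fin n) ℝ) := {U | U.PosDef}

/-- The right stretch tensor `U = √(FᵀF)`; the square root of the positive semidefinite matrix
`FᵀF` is taken on eigenvalues (functional calculus of symmetric matrices). -/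
noncomputable def rightStretch {n : ℕ} (F : Matrix (Fin n) (Fin n) ℝ) :
    Matrix (Fin n) (Fin n) ℝ := cfc Real.sqrt (Fᵀ * F)

/-- The logarithm of a symmetric positive definite matrix, taken on eigenvalues (functional
calculus of symmetric matrices). -/
noncomputable def matLog {n : ℕ} (U : Matrix (Fin n) (Fin n) ℝ) :
    Matrix (Fin n) (Fin n) ℝ := cfc Real.log U

/-- The deviatoric part `dev_n X = X - (tr X / n) • 1`. -/
noncomputable def dev {n : ℕ} (X : Matrix (Fin n) (Fin n) ℝ) : Matrix (Fin n) (Fin n) ℝ :=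
  X - (X.trace / (n : ℝ)) • (1 : Matrix (Fin n) (Fin n) ℝ)

end Hencky

-- Matrices carry the Frobenius norm from here on.
attribute [local instance] Matrix.frobeniusNormedAddCommGroup Matrix.frobeniusNormedSpace

namespace Hencky

/-- `‖dev_n log U‖²` as a function of the stretch tensor `U`, with the Frobenius norm. -/
noncomputable def devLogNormSq {n : ℕ} (U : Matrix (Fin n) (Fin n) ℝ) : ℝ :=
  ‖dev (matLog U)‖ ^ 2

/-- The energy `F ↦ ‖dev_n log U‖²` with `U = √(FᵀF)`. It is of interest on `GL⁺(n)` only, which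
is open, so that values elsewhere have no influence on derivatives at points of `GL⁺(n)`. -/
noncomputable def isoEnergy (n : ℕ) (F : Matrix (Fin n) (Fin n) ℝ) : ℝ :=
  devLogNormSq (rightStretch F)

/-- The Legendre–Hadamard condition for `W` at `F`:
`D²W(F).(ξ ⊗ η, ξ ⊗ η) ≥ 0` for all `ξ, η ∈ ℝⁿ`. -/
def IsLHElliptic {n : ℕ} (W : Matrix (Fin n) (Fin n) ℝ → ℝ) (F : Matrix (Fin n) (Fin n) ℝ) :
    Prop :=
  ∀ ξ η : Fin n → ℝ,
    0 ≤ fderiv ℝ (fderiv ℝ W) F (Matrix.vecMulVec ξ η) (Matrix.vecMulVec ξ η)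

/-- The maximal ellipticity domain of `W`: the set of all points of `GL⁺(n)` at which `W` is
Legendre–Hadamard elliptic. -/
def maximalEllipticityDomain {n : ℕ} (W : Matrix (Fin n) (Fin n) ℝ → ℝ) :
    Set (Matrix (Fin n) (Fin n) ℝ) :=
  {F | F ∈ GLplus n ∧ IsLHElliptic W F}

/-- The set `{U ∈ PSym(n) | ‖dev_n log U‖² ≤ c}` of stretch tensors. -/
def stretchDomain (n : ℕ) (c : ℝ) : Set (Matrix (Fin n) (Fin n) ℝ) :=
  {U | U ∈ PSym n ∧ devLogNormSq U ≤ c}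

/-- The `i`-th singular value (in descending order, counted from `0`) of a square matrix, as a
linear map of Euclidean space. -/
noncomputable def singVal {n : ℕ} (F : Matrix (Fin n) (Fin n) ℝ) (i : ℕ) : ℝ :=
  (Matrix.toEuclideanLin F).singularValues i

end Hencky

/-! Identify ℝ² with ℂ and write `F z = a z + b z̄`. The singular values of `F` are `|a| ± |b|`, so
with `r = |b| / |a| < 1` the energy is `½ log²(λ₁/λ₂) = 2 artanh² r = 2 s p(s)²`, where `s = r²` and
`p(s) = artanh √s / √s`. Since `p` is given by a power series, it is analytic also at `s = 0`, which
gives smoothness at the conformal matrices `b = 0`.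

A rank-one `H` has zero determinant, so its conformal and anticonformal parts have equal modulus.
For `H ≠ 0`, `D²W(F).(H,H)` is then a positive multiple of a quadratic form in `x, y ∈ [-1, 1]`, the
cosines of the angles between the anticonformal, respectively conformal, parts of `F` and `H`
(`fderiv_fderiv_isoEnergy_eq`). At `x = y = 1` this form equals `(1 - r)² (1 - 2 r p)`, and `2 r p ≤
1` says exactly that the energy is at most `1/2`. Necessity: for `b ≠ 0` some rank-one direction
attains `x = y = 1` (`exists_rankOne_aligned`). Sufficiency: if `2 r p ≤ 1`, the form is nonnegative
on the whole square (`rankOneForm_nonneg`). -/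

namespace Hencky

/-! ### The analytic function `artanh √s / √s` -/

/-- The power series `∑ sᵏ / (2k + 1)`, which is `artanh √s / √s` for `0 < s < 1`. -/
noncomputable def artanhSeries : ℝ → ℝ :=
  FormalMultilinearSeries.ofScalarsSum (fun k : ℕ => (1 : ℝ) / (2 * k + 1))

lemma artanhSeries_radius :
    (FormalMultilinearSeries.ofScalars ℝ (fun k : ℕ => (1 : ℝ) / (2 * k + 1))).radius = 1 := by
  have h := FormalMultilinearSeries.ofScalars_radius_eq_of_tendsto ℝ
    (fun k : ℕ => (1 : ℝ) / (2 * k + 1)) (r := 1) one_ne_zero (by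
      have h1 : Filter.Tendsto (fun k : ℕ => 1 + (2 : ℝ) * (2 * (k : ℝ) + 1)⁻¹) Filter.atTop
          (nhds (1 + 2 * 0)) := by
        refine (Filter.Tendsto.const_mul _ ?_).const_add _
        refine Filter.Tendsto.comp tendsto_inv_atTop_zero ?_
        exact Filter.tendsto_atTop_add_const_right _ _
          (Filter.Tendsto.const_mul_atTop two_pos tendsto_natCast_atTop_atTop)
      norm_num at h1 ⊢
      refine h1.congr fun k => ?_
      have : (0 : ℝ) < 2 * k + 1 := by positivity
      have : (0 : ℝ) < 2 * (k + 1) + 1 := by positivity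
      rw [abs_of_pos (by assumption), abs_of_pos (by assumption)]
      field_simp
      ring)
  simpa using h

lemma analyticAt_artanhSeries {s : ℝ} (hs : |s| < 1) : AnalyticAt ℝ artanhSeries s := by
  have h := (FormalMultilinearSeries.ofScalars ℝ
    (fun k : ℕ => (1 : ℝ) / (2 * k + 1))).hasFPowerSeriesOnBall (by
      rw [artanhSeries_radius]; exact one_pos)
  refine h.analyticAt_of_mem ?_
  rw [artanhSeries_radius]
  simp only [Metric.mem_eball, edist_dist, dist_zero_right, Real.norm_eq_abs]
  exact ENNReal.ofReal_lt_one.2 hs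

lemma artanhSeries_zero : artanhSeries 0 = 1 := by
  simp [artanhSeries]

/-- `artanh r = r · artanhSeries (r²)`, with `artanh` in logarithmic form. -/
lemma log_sub_log_eq_mul_artanhSeries {r : ℝ} (hr : |r| < 1) :
    Real.log (1 + r) - Real.log (1 - r) = 2 * r * artanhSeries (r ^ 2) := by
  rw [← (Real.hasSum_log_sub_log_of_abs_lt_one hr).tsum_eq, artanhSeries,
    FormalMultilinearSeries.ofScalarsSum_eq_tsum, ← tsum_mul_left]
  refine tsum_congr fun k => ?_
  simp only [smul_eq_mul]
  ring

lemma artanhSeries_eq {s : ℝ} (h0 : 0 < s) (h1 : s < 1) :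
    artanhSeries s = (Real.log (1 + √s) - Real.log (1 - √s)) / (2 * √s) := by
  have hs : 0 < √s := Real.sqrt_pos.2 h0
  have hs1 : √s < 1 := by rw [Real.sqrt_lt' one_pos]; simpa
  rw [log_sub_log_eq_mul_artanhSeries (by rwa [abs_of_pos hs]), Real.sq_sqrt h0.le]
  field_simp

lemma hasDerivAt_artanhSeries {s : ℝ} (hs : |s| < 1) :
    HasDerivAt artanhSeries (deriv artanhSeries s) s :=
  (analyticAt_artanhSeries hs).differentiableAt.hasDerivAt

/-- The differential equation of `artanhSeries`. -/
lemma deriv_artanhSeries {s : ℝ} (h0 : 0 ≤ s) (h1 : s < 1) :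
    2 * s * deriv artanhSeries s = 1 / (1 - s) - artanhSeries s := by
  rcases h0.eq_or_lt with rfl | h0
  · simp [artanhSeries_zero]
  have hs : 0 < √s := Real.sqrt_pos.2 h0
  have hs1 : √s < 1 := by rw [Real.sqrt_lt' one_pos]; simpa
  have hss : √s ^ 2 = s := Real.sq_sqrt h0.le
  have hd := Real.hasDerivAt_sqrt h0.ne'
  have h2 := (((hd.const_add 1).log (by positivity)).sub
    ((hd.const_sub 1).log (by linarith))).div (hd.const_mul 2) (by positivity)
  have h3 : artanhSeries =ᶠ[nhds s]
      fun s => (Real.log (1 + √s) - Real.log (1 - √s)) / (2 * √s) := by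
    filter_upwards [Ioo_mem_nhds h0 h1] with x hx using artanhSeries_eq hx.1 hx.2
  rw [(h2.congr_of_eventuallyEq h3).deriv, artanhSeries_eq h0 h1]
  simp only [Pi.sub_apply]
  generalize Real.log (1 + √s) - Real.log (1 - √s) = L
  generalize √s = q at *
  subst hss
  have : 1 - q ≠ 0 := by linarith
  have : 1 + q ≠ 0 := by linarith
  have : 1 - q ^ 2 ≠ 0 := by nlinarith
  field_simp
  ring

lemma hasSum_artanhSeries {s : ℝ} (h0 : 0 ≤ s) (h1 : s < 1) :
    HasSum (fun k : ℕ => 1 / (2 * (k : ℝ) + 1) * s ^ k) (artanhSeries s) := by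
  have hsum : Summable (fun k : ℕ => 1 / (2 * (k : ℝ) + 1) * s ^ k) := by
    refine Summable.of_nonneg_of_le (fun k => by positivity) (fun k => ?_)
      (summable_geometric_of_lt_one h0 h1)
    refine mul_le_of_le_one_left (by positivity) ?_
    rw [div_le_one (by positivity)]
    linarith [k.cast_nonneg (α := ℝ)]
  have := hsum.hasSum
  rwa [show ∑' k : ℕ, 1 / (2 * (k : ℝ) + 1) * s ^ k = artanhSeries s by
    simp [artanhSeries, FormalMultilinearSeries.ofScalarsSum_eq_tsum]] at this

lemma one_le_artanhSeries {s : ℝ} (h0 : 0 ≤ s) (h1 : s < 1) : 1 ≤ artanhSeries s := by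
  have := (hasSum_artanhSeries h0 h1).summable.le_tsum 0 fun k _ => by positivity
  rw [(hasSum_artanhSeries h0 h1).tsum_eq] at this
  simpa using this

/-- Termwise comparison with the geometric series. The bounds `1 ≤ p ≤ 1 / (1 - s)` are all that the
inequality for the form uses about `p`, besides `2 r p ≤ 1`. -/
lemma artanhSeries_mul_le_one {s : ℝ} (h0 : 0 ≤ s) (h1 : s < 1) :
    artanhSeries s * (1 - s) ≤ 1 := by
  rw [← le_div_iff₀ (by linarith), one_div]
  refine hasSum_le (fun k => ?_) (hasSum_artanhSeries h0 h1) (hasSum_geometric_of_lt_one h0 h1)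
  refine mul_le_of_le_one_left (by positivity) ?_
  rw [div_le_one (by positivity)]
  linarith [k.cast_nonneg (α := ℝ)]

/-! ### Nonnegativity of the rank-one form -/

/-- Taylor expansion at `v`: value, slope times `u - v`, and `A (u - v)²` are all nonnegative. -/
lemma convex_quadratic_nonneg {A B C u v : ℝ} (hv : 0 ≤ A * v ^ 2 + B * v + C)
    (hA : 0 ≤ A) (hd : 0 ≤ (2 * A * v + B) * (u - v)) : 0 ≤ A * u ^ 2 + B * u + C := by
  nlinarith [mul_nonneg hA (sq_nonneg (u - v))]

/-- The second derivative of the energy along a rank-one line, up to a positive factor. -/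
lemma rankOneForm_nonneg_of_nonneg {p r x y : ℝ} (hr0 : 0 ≤ r) (hr1 : r < 1) (hp : 1 ≤ p)
    (hps : p * (1 - r ^ 2) ≤ 1) (ht : 2 * r * p ≤ 1) (hx : x ≤ 1) (hy : y ≤ 1)
    (hu : 0 ≤ x - r * y) :
    0 ≤ (1 - p + 3 * p * r ^ 2) * (x - r * y) ^ 2 +
      p * (1 - r ^ 2) * ((1 - r ^ 2) - 4 * r * y * (x - r * y)) := by
  have hA : 0 ≤ 1 - p + 3 * p * r ^ 2 := by nlinarith
  have hs : 0 < 1 - r ^ 2 := by nlinarith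
  have hps0 : 0 ≤ p * (1 - r ^ 2) := by positivity
  -- This is the value of the form at `x = y = 1`, where `u = 1 - r`.
  have hend : 0 ≤ (1 - r) ^ 2 * (1 - 2 * r * p) := mul_nonneg (sq_nonneg _) (by linarith)
  generalize hudef : x - r * y = u at *
  rcases le_total u (1 - r) with h | h
  -- Replacing `y` by `1` while keeping `u` lowers the form to a convex quadratic in `u` that has
  -- value `hend` and nonpositive slope at `1 - r`.
  · have h1 : 0 ≤ (1 - p + 3 * p * r ^ 2) * u ^ 2 + (-4 * r * p * (1 - r ^ 2)) * u +
        p * (1 - r ^ 2) ^ 2 := by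
      refine convex_quadratic_nonneg (v := 1 - r) (by linarith) hA ?_
      refine mul_nonneg_of_nonpos_of_nonpos ?_ (by linarith)
      have : 1 - p - 2 * p * r + p * r ^ 2 ≤ 0 := by nlinarith
      nlinarith [mul_nonneg (sub_nonneg.2 hr1.le) (neg_nonneg.2 this)]
    have h2 : 0 ≤ p * (1 - r ^ 2) * (4 * r * ((1 - y) * u)) :=
      mul_nonneg hps0 (mul_nonneg (by positivity) (mul_nonneg (by linarith) hu))
    linarith
  -- Here `r y = x - u`, and `x` is replaced by `1` instead; the new quadratic has the same value at
  -- `1 - r`, now with nonnegative slope.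
  · have h1 : 0 ≤ (1 - p + 3 * p * r ^ 2 + 4 * p * (1 - r ^ 2)) * u ^ 2 +
        (-4 * p * (1 - r ^ 2)) * u + p * (1 - r ^ 2) ^ 2 := by
      refine convex_quadratic_nonneg (v := 1 - r) (by linarith) (by linarith) ?_
      refine mul_nonneg ?_ (by linarith)
      have : 0 ≤ (1 - 2 * r * p) + p * (1 - r ^ 2) := by linarith
      nlinarith [mul_nonneg (sub_nonneg.2 hr1.le) this]
    have h2 : 0 ≤ p * (1 - r ^ 2) * (4 * u * (1 - x)) :=
      mul_nonneg hps0 (mul_nonneg (by positivity) (by linarith))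
    have h3 : r * y = x - u := by linarith
    rw [show 4 * r * y * u = 4 * (r * y) * u by ring, h3]
    linarith

lemma rankOneForm_nonneg {p r x y : ℝ} (hr0 : 0 ≤ r) (hr1 : r < 1) (hp : 1 ≤ p)
    (hps : p * (1 - r ^ 2) ≤ 1) (ht : 2 * r * p ≤ 1) (hx : |x| ≤ 1) (hy : |y| ≤ 1) :
    0 ≤ (1 - p + 3 * p * r ^ 2) * (x - r * y) ^ 2 +
      p * (1 - r ^ 2) * ((1 - r ^ 2) - 4 * r * y * (x - r * y)) := by
  rw [abs_le] at hx hy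
  rcases le_total 0 (x - r * y) with h | h
  · exact rankOneForm_nonneg_of_nonneg hr0 hr1 hp hps ht hx.2 hy.2 h
  · have := rankOneForm_nonneg_of_nonneg (x := -x) (y := -y) hr0 hr1 hp hps ht (by linarith)
      (by linarith) (by linarith)
    linarith

/-! ### The energy in terms of eigenvalues -/

lemma trace_cfc {n : ℕ} {C : Matrix (Fin n) (Fin n) ℝ} (hC : C.IsHermitian) (f : ℝ → ℝ) :
    (cfc f C).trace = ∑ i, f (hC.eigenvalues i) := by
  rw [hC.cfc_eq, Matrix.IsHermitian.cfc, Unitary.conjStarAlgAut_apply, Matrix.trace_mul_cycle]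
  simp [Matrix.trace_diagonal]

lemma frobenius_norm_sq {n : ℕ} (X : Matrix (Fin n) (Fin n) ℝ) :
    ‖X‖ ^ 2 = (Xᵀ * X).trace := by
  rw [Matrix.frobenius_norm_def, ← Real.rpow_natCast, ← Real.rpow_mul (by positivity)]
  norm_num
  rw [Finset.sum_comm]
  simp [Matrix.trace, Matrix.mul_apply, sq]

lemma frobenius_norm_sq_dev {X : Matrix (Fin 2) (Fin 2) ℝ} (hX : X.IsSymm) :
    ‖dev X‖ ^ 2 = (X * X).trace - X.trace ^ 2 / 2 := by
  have h : X 1 0 = X 0 1 := hX.apply 0 1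
  rw [frobenius_norm_sq]
  simp [dev, Matrix.trace_fin_two, Matrix.mul_apply, Fin.sum_univ_two, h]
  ring

lemma devLogNormSq_rightStretch {F : Matrix (Fin 2) (Fin 2) ℝ} (hC : (Fᵀ * F).IsHermitian) :
    devLogNormSq (rightStretch F) =
      (Real.log (√(hC.eigenvalues 0)) - Real.log (√(hC.eigenvalues 1))) ^ 2 / 2 := by
  -- The spectrum is finite, so the continuity side conditions of the functional calculus hold for
  -- every function.
  have hcont : ∀ (f : ℝ → ℝ) (s : Set ℝ), s.Finite → ContinuousOn f s := fun f s hs =>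
    hs.continuousOn f
  have hfin : (spectrum ℝ (Fᵀ * F)).Finite := Matrix.finite_real_spectrum
  have hlog : matLog (rightStretch F) = cfc (fun x => Real.log (√x)) (Fᵀ * F) := by
    exact (cfc_comp' Real.log Real.sqrt (Fᵀ * F) (hcont _ _ (hfin.image _))
      (hcont _ _ hfin) hC).symm
  have hsymm : (cfc (fun x => Real.log (√x)) (Fᵀ * F)).IsSymm := by
    have := cfc_predicate (fun x => Real.log (√x)) (Fᵀ * F)
    simpa [Matrix.IsSymm, IsSelfAdjoint, Matrix.star_eq_conjTranspose] using this
  rw [devLogNormSq, hlog, frobenius_norm_sq_dev hsymm,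
    ← cfc_mul _ _ _ (hcont _ _ hfin) (hcont _ _ hfin), trace_cfc hC, trace_cfc hC]
  simp only [Fin.sum_univ_two]
  ring

/-! ### Conformal coordinates and the Beltrami coefficient -/

/-- `|a|²`, where `F z = a z + b z̄` as a map of the complex plane. -/
noncomputable def conformalNormSq (F : Matrix (Fin 2) (Fin 2) ℝ) : ℝ :=
  ((F 0 0 + F 1 1) ^ 2 + (F 1 0 - F 0 1) ^ 2) / 4

/-- `|b|²`, where `F z = a z + b z̄` as a map of the complex plane. -/
noncomputable def anticonformalNormSq (F : Matrix (Fin 2) (Fin 2) ℝ) : ℝ :=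
  ((F 0 0 - F 1 1) ^ 2 + (F 1 0 + F 0 1) ^ 2) / 4

/-- The squared modulus of the Beltrami coefficient `b / a` of `F z = a z + b z̄`. -/
noncomputable def beltramiSq (F : Matrix (Fin 2) (Fin 2) ℝ) : ℝ :=
  anticonformalNormSq F / conformalNormSq F

variable {F : Matrix (Fin 2) (Fin 2) ℝ}

lemma det_eq_conformal_sub (F : Matrix (Fin 2) (Fin 2) ℝ) :
    F.det = conformalNormSq F - anticonformalNormSq F := by
  rw [Matrix.det_fin_two, conformalNormSq, anticonformalNormSq]; ring

lemma trace_transpose_mul_self (F : Matrix (Fin 2) (Fin 2) ℝ) :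
    (Fᵀ * F).trace = 2 * (conformalNormSq F + anticonformalNormSq F) := by
  simp [Matrix.trace_fin_two, Matrix.mul_apply, Fin.sum_univ_two, conformalNormSq,
    anticonformalNormSq]
  ring

lemma anticonformalNormSq_nonneg (F : Matrix (Fin 2) (Fin 2) ℝ) : 0 ≤ anticonformalNormSq F := by
  rw [anticonformalNormSq]; positivity

lemma conformalNormSq_pos (hF : F ∈ GLplus 2) : 0 < conformalNormSq F := by
  have h : 0 < F.det := hF
  rw [det_eq_conformal_sub] at h
  linarith [anticonformalNormSq_nonneg F]

lemma beltramiSq_nonneg (hF : F ∈ GLplus 2) : 0 ≤ beltramiSq F :=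
  div_nonneg (anticonformalNormSq_nonneg F) (conformalNormSq_pos hF).le

lemma beltramiSq_lt_one (hF : F ∈ GLplus 2) : beltramiSq F < 1 := by
  rw [beltramiSq, div_lt_one (conformalNormSq_pos hF)]
  have h : 0 < F.det := hF
  rw [det_eq_conformal_sub] at h
  linarith

/-- The energy as a function of the squared modulus of the Beltrami coefficient. -/
noncomputable def energyProfile (s : ℝ) : ℝ := 2 * s * artanhSeries s ^ 2

/-- The two equations force `{μ, ν} = {|a| + |b|, |a| - |b|}`. Allowing any such pair covers both
the square roots of the eigenvalues of `FᵀF` and the singular values, with no need to match the two.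
-/
lemma log_quotient_sq_of_sum_of_mul {F : Matrix (Fin 2) (Fin 2) ℝ} (hF : F ∈ GLplus 2) {μ ν : ℝ}
    (hμ : 0 < μ) (hν : 0 < ν) (hadd : μ ^ 2 + ν ^ 2 = (Fᵀ * F).trace) (hmul : μ * ν = F.det) :
    (Real.log μ - Real.log ν) ^ 2 = 2 * energyProfile (beltramiSq F) := by
  wlog h : ν ≤ μ generalizing μ ν
  · rw [← this hν hμ (by linarith) (by linarith) (le_of_not_ge h)]; ring
  have hM := conformalNormSq_pos hF
  rw [trace_transpose_mul_self] at hadd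
  rw [det_eq_conformal_sub] at hmul
  have hM' : conformalNormSq F = ((μ + ν) / 2) ^ 2 := by linarith
  have hN' : anticonformalNormSq F = ((μ - ν) / 2) ^ 2 := by linarith
  set r := (μ - ν) / (μ + ν) with hr
  have hpos : 0 < μ + ν := by linarith
  have hs : beltramiSq F = r ^ 2 := by
    rw [beltramiSq, hM', hN', hr]; field_simp
  have hr0 : 0 ≤ r := div_nonneg (by linarith) hpos.le
  have hr1 : r < 1 := by rw [hr, div_lt_one hpos]; linarith
  have h1 : 1 + r = μ * (2 / (μ + ν)) := by rw [hr]; field_simp; ring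
  have h2 : 1 - r = ν * (2 / (μ + ν)) := by rw [hr]; field_simp; ring
  have h3 := log_sub_log_eq_mul_artanhSeries (r := r) (by rwa [abs_of_nonneg hr0])
  rw [h1, h2, Real.log_mul hμ.ne' (by positivity), Real.log_mul hν.ne' (by positivity)] at h3
  rw [energyProfile, hs, show Real.log μ - Real.log ν = 2 * r * artanhSeries (r ^ 2) by linarith]
  ring

lemma posDef_transpose_mul_self (hF : F ∈ GLplus 2) : (Fᵀ * F).PosDef := by
  have hdet : 0 < F.det := hF
  have := Matrix.PosDef.conjTranspose_mul_self F
    (Matrix.mulVec_injective_of_isUnit ((Matrix.isUnit_iff_isUnit_det F).2 hdet.ne'.isUnit))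
  simpa using this

lemma isoEnergy_eq (hF : F ∈ GLplus 2) : isoEnergy 2 F = energyProfile (beltramiSq F) := by
  have hP := posDef_transpose_mul_self hF
  have hC := hP.isHermitian
  have hdet : 0 < F.det := hF
  have h0 := hP.eigenvalues_pos
  rw [isoEnergy, devLogNormSq_rightStretch hC,
    log_quotient_sq_of_sum_of_mul hF (Real.sqrt_pos.2 (h0 0)) (Real.sqrt_pos.2 (h0 1))]
  · ring
  · rw [Real.sq_sqrt (h0 0).le, Real.sq_sqrt (h0 1).le, hC.trace_eq_sum_eigenvalues]
    simp
  · have := hC.det_eq_prod_eigenvalues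
    rw [Matrix.det_mul, Matrix.det_transpose] at this
    simp only [RCLike.ofReal_real_eq_id, id_eq, Fin.prod_univ_two] at this
    rw [← Real.sqrt_mul (h0 0).le, ← this, Real.sqrt_mul_self hdet.le]

lemma rightStretch_mem_PSym (hF : F ∈ GLplus 2) : rightStretch F ∈ PSym 2 := by
  have hP := posDef_transpose_mul_self hF
  have hC := hP.isHermitian
  change (rightStretch F).PosDef
  rw [rightStretch, hC.cfc_eq, Matrix.IsHermitian.cfc, Unitary.conjStarAlgAut_apply]
  have hd : (Matrix.diagonal (RCLike.ofReal ∘ Real.sqrt ∘ hC.eigenvalues) :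
      Matrix (Fin 2) (Fin 2) ℝ).PosDef := by
    refine Matrix.PosDef.diagonal fun i => ?_
    simpa using hP.eigenvalues_pos i
  exact (Matrix.IsUnit.posDef_star_right_conjugate_iff
    Unitary.isUnit_coe).2 hd

/-! ### Singular values -/

lemma adjoint_comp_toEuclideanLin (F : Matrix (Fin 2) (Fin 2) ℝ) :
    LinearMap.adjoint (Matrix.toEuclideanLin F) ∘ₗ Matrix.toEuclideanLin F =
      Matrix.toEuclideanLin (Fᵀ * F) := by
  rw [← Matrix.toEuclideanLin_conjTranspose_eq_adjoint]
  ext v i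
  simp [Matrix.toLpLin_apply]

lemma singVal_sq_add_sq (F : Matrix (Fin 2) (Fin 2) ℝ) :
    singVal F 0 ^ 2 + singVal F 1 ^ 2 = (Fᵀ * F).trace := by
  have hn : Module.finrank ℝ (EuclideanSpace ℝ (Fin 2)) = 2 := by simp
  rw [singVal, singVal, LinearMap.sq_singularValues_of_lt _ hn two_pos,
    LinearMap.sq_singularValues_of_lt _ hn one_lt_two]
  have h := (Matrix.toEuclideanLin F).isSymmetric_adjoint_comp_self.trace_eq_sum_eigenvalues hn
  have h2 : LinearMap.trace ℝ _ (Matrix.toEuclideanLin (Fᵀ * F)) = (Fᵀ * F).trace := by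
    rw [Matrix.toEuclideanLin, Matrix.toLpLin_eq_toLin, Matrix.trace_toLin_eq]
  rw [← h2, ← adjoint_comp_toEuclideanLin, h]
  simp

lemma singVal_mul (hF : F ∈ GLplus 2) : singVal F 0 * singVal F 1 = F.det := by
  have hdet : 0 < F.det := hF
  have hn : Module.finrank ℝ (EuclideanSpace ℝ (Fin 2)) = 2 := by simp
  have h0 : 0 ≤ singVal F 0 * singVal F 1 :=
    mul_nonneg (LinearMap.singularValues_nonneg _ _) (LinearMap.singularValues_nonneg _ _)
  refine (pow_left_inj₀ h0 hdet.le two_ne_zero).1 ?_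
  rw [mul_pow, singVal, singVal, LinearMap.sq_singularValues_of_lt _ hn two_pos,
    LinearMap.sq_singularValues_of_lt _ hn one_lt_two]
  have h := (Matrix.toEuclideanLin F).isSymmetric_adjoint_comp_self.det_eq_prod_eigenvalues hn
  have h2 : LinearMap.det (Matrix.toEuclideanLin (Fᵀ * F)) = (Fᵀ * F).det :=
    LinearMap.det_toLpLin _ _
  rw [← adjoint_comp_toEuclideanLin, h, Matrix.det_mul, Matrix.det_transpose] at h2
  simp only [Fin.prod_univ_two] at h2
  rw [sq, ← h2]
  rfl

lemma log_singVal_div_sq (hF : F ∈ GLplus 2) :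
    Real.log (singVal F 0 / singVal F 1) ^ 2 = 2 * isoEnergy 2 F := by
  have hdet : 0 < F.det := hF
  have hmul := singVal_mul hF
  have h0 : 0 ≤ singVal F 0 := LinearMap.singularValues_nonneg _ _
  have h1 : 0 ≤ singVal F 1 := LinearMap.singularValues_nonneg _ _
  have h0 : 0 < singVal F 0 := h0.lt_of_ne fun h => by rw [← h, zero_mul] at hmul; linarith
  have h1 : 0 < singVal F 1 := h1.lt_of_ne fun h => by rw [← h, mul_zero] at hmul; linarith
  rw [Real.log_div h0.ne' h1.ne',
    log_quotient_sq_of_sum_of_mul hF h0 h1 (singVal_sq_add_sq F) hmul, isoEnergy_eq hF]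

/-! ### Smoothness and the second derivative along lines -/

lemma fderiv_fderiv_apply_self {E : Type*} [NormedAddCommGroup E] [NormedSpace ℝ E] {f : E → ℝ}
    {x h : E} {g : ℝ → ℝ} {c : ℝ} (hf : ContDiffAt ℝ 2 f x)
    (hg : ∀ᶠ τ in nhds (0 : ℝ), HasDerivAt (fun τ : ℝ => f (x + τ • h)) (g τ) τ)
    (hc : HasDerivAt g c 0) : fderiv ℝ (fderiv ℝ f) x h h = c := by
  have hline : ∀ τ : ℝ, HasDerivAt (fun τ : ℝ => x + τ • h) h τ := fun τ => by
    simpa using ((hasDerivAt_id τ).smul_const h).const_add x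
  have h1 : DifferentiableAt ℝ (fderiv ℝ f) x :=
    (hf.fderiv_right (m := 1) (by norm_num)).differentiableAt (by norm_num)
  have h2 : ∀ᶠ y in nhds x, DifferentiableAt ℝ f y := by
    filter_upwards [hf.eventually (by simp)] with y hy using hy.differentiableAt (by norm_num)
  have h3 : Filter.Tendsto (fun τ : ℝ => x + τ • h) (nhds 0) (nhds x) := by
    simpa [ContinuousAt] using (hline 0).continuousAt
  have h4 : g =ᶠ[nhds 0] fun τ => fderiv ℝ f (x + τ • h) h := by
    filter_upwards [hg, h3.eventually h2] with τ hτ hτ'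
    exact hτ.unique (hτ'.hasFDerivAt.comp_hasDerivAt τ (hline τ))
  have h5 : HasDerivAt (fun τ : ℝ => fderiv ℝ f (x + τ • h)) (fderiv ℝ (fderiv ℝ f) x h) 0 := by
    have : HasFDerivAt (fderiv ℝ f) (fderiv ℝ (fderiv ℝ f) x) (x + (0 : ℝ) • h) := by
      simpa using h1.hasFDerivAt
    exact this.comp_hasDerivAt 0 (hline 0)
  have h6 := h5.clm_apply (hasDerivAt_const 0 h)
  simp only [map_zero, add_zero] at h6
  exact (h6.congr_of_eventuallyEq h4).unique hc

lemma contDiff_entry {n : WithTop ℕ∞} (i j : Fin 2) :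
    ContDiff ℝ n (fun F : Matrix (Fin 2) (Fin 2) ℝ => F i j) :=
  (LinearMap.toContinuousLinearMap (Matrix.entryLinearMap ℝ ℝ i j)).contDiff

lemma contDiff_conformalNormSq : ContDiff ℝ 2 conformalNormSq := by
  have := @contDiff_entry 2
  unfold conformalNormSq
  exact ((((this 0 0).add (this 1 1)).pow 2).add (((this 1 0).sub (this 0 1)).pow 2)).div_const 4

lemma contDiff_anticonformalNormSq : ContDiff ℝ 2 anticonformalNormSq := by
  have := @contDiff_entry 2
  unfold anticonformalNormSq
  exact ((((this 0 0).sub (this 1 1)).pow 2).add (((this 1 0).add (this 0 1)).pow 2)).div_const 4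

lemma isOpen_GLplus : IsOpen (GLplus 2) := by
  have h : GLplus 2 = {F | 0 < conformalNormSq F - anticonformalNormSq F} := by
    ext F; simp [GLplus, det_eq_conformal_sub]
  rw [h]
  exact isOpen_lt continuous_const
    (contDiff_conformalNormSq.continuous.sub contDiff_anticonformalNormSq.continuous)

lemma analyticAt_energyProfile {s : ℝ} (hs : |s| < 1) : AnalyticAt ℝ energyProfile s :=
  (show AnalyticAt ℝ (fun s : ℝ => 2 * s) s by fun_prop).mul ((analyticAt_artanhSeries hs).pow 2)

lemma contDiffOn_isoEnergy : ContDiffOn ℝ 2 (isoEnergy 2) (GLplus 2) := by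
  refine ContDiffOn.congr (f := fun F => energyProfile (beltramiSq F)) ?_
    fun F hF => isoEnergy_eq hF
  intro F hF
  refine ContDiffAt.contDiffWithinAt ?_
  have h1 : ContDiffAt ℝ 2 beltramiSq F :=
    contDiff_anticonformalNormSq.contDiffAt.div contDiff_conformalNormSq.contDiffAt
      (conformalNormSq_pos hF).ne'
  have hs : |beltramiSq F| < 1 := by
    rw [abs_of_nonneg (beltramiSq_nonneg hF)]
    exact beltramiSq_lt_one hF
  exact (analyticAt_energyProfile hs).contDiffAt.comp F h1

/-- The differential equation of `artanhSeries` cancels its derivative. -/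
lemma hasDerivAt_energyProfile {s : ℝ} (h0 : 0 ≤ s) (h1 : s < 1) :
    HasDerivAt energyProfile (2 * artanhSeries s / (1 - s)) s := by
  have hs : |s| < 1 := by rwa [abs_of_nonneg h0]
  have h := ((hasDerivAt_id s).const_mul 2).mul ((hasDerivAt_artanhSeries hs).pow 2)
  refine h.congr_deriv ?_
  have h2 := deriv_artanhSeries h0 h1
  simp only [id, Pi.pow_apply]
  linear_combination (2 * artanhSeries s) * h2

lemma hasDerivAt_deriv_energyProfile {s : ℝ} (h0 : 0 ≤ s) (h1 : s < 1) :
    HasDerivAt (fun s => 2 * artanhSeries s / (1 - s))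
      (2 * deriv artanhSeries s / (1 - s) + 2 * artanhSeries s / (1 - s) ^ 2) s := by
  have hs : |s| < 1 := by rwa [abs_of_nonneg h0]
  have hne : 1 - s ≠ 0 := by linarith
  refine (((hasDerivAt_artanhSeries hs).const_mul 2).div ((hasDerivAt_id s).const_sub 1)
    hne).congr_deriv ?_
  simp only [id]
  field_simp
  ring

/-- The polar form of `conformalNormSq`. -/
noncomputable def conformalInner (F H : Matrix (Fin 2) (Fin 2) ℝ) : ℝ :=
  ((F 0 0 + F 1 1) * (H 0 0 + H 1 1) + (F 1 0 - F 0 1) * (H 1 0 - H 0 1)) / 4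

/-- The polar form of `anticonformalNormSq`. -/
noncomputable def anticonformalInner (F H : Matrix (Fin 2) (Fin 2) ℝ) : ℝ :=
  ((F 0 0 - F 1 1) * (H 0 0 - H 1 1) + (F 1 0 + F 0 1) * (H 1 0 + H 0 1)) / 4

lemma conformalNormSq_add_smul (F H : Matrix (Fin 2) (Fin 2) ℝ) (τ : ℝ) :
    conformalNormSq (F + τ • H) =
      conformalNormSq F + 2 * conformalInner F H * τ + conformalNormSq H * τ ^ 2 := by
  simp only [conformalNormSq, conformalInner, Matrix.add_apply, Matrix.smul_apply, smul_eq_mul]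
  ring

lemma anticonformalNormSq_add_smul (F H : Matrix (Fin 2) (Fin 2) ℝ) (τ : ℝ) :
    anticonformalNormSq (F + τ • H) =
      anticonformalNormSq F + 2 * anticonformalInner F H * τ + anticonformalNormSq H * τ ^ 2 := by
  simp only [anticonformalNormSq, anticonformalInner, Matrix.add_apply, Matrix.smul_apply,
    smul_eq_mul]
  ring

/-- Cauchy–Schwarz in the plane; the square supplied is the remainder in Lagrange's identity. -/
lemma conformalInner_sq_le (F H : Matrix (Fin 2) (Fin 2) ℝ) :
    conformalInner F H ^ 2 ≤ conformalNormSq F * conformalNormSq H := by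
  simp only [conformalNormSq, conformalInner]
  nlinarith [sq_nonneg ((F 0 0 + F 1 1) * (H 1 0 - H 0 1) - (F 1 0 - F 0 1) * (H 0 0 + H 1 1))]

lemma anticonformalInner_sq_le (F H : Matrix (Fin 2) (Fin 2) ℝ) :
    anticonformalInner F H ^ 2 ≤ anticonformalNormSq F * anticonformalNormSq H := by
  simp only [anticonformalNormSq, anticonformalInner]
  nlinarith [sq_nonneg ((F 0 0 - F 1 1) * (H 1 0 + H 0 1) - (F 1 0 + F 0 1) * (H 0 0 - H 1 1))]

lemma hasDerivAt_quadratic (a b c τ : ℝ) :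
    HasDerivAt (fun τ : ℝ => a + 2 * b * τ + c * τ ^ 2) (2 * b + 2 * c * τ) τ := by
  refine ((((hasDerivAt_id τ).const_mul (2 * b)).const_add a).add
    (((hasDerivAt_id τ).pow 2).const_mul c)).congr_deriv ?_
  simp only [id]
  norm_num
  ring

/-- Along `F + τ H` the squared Beltrami modulus is a quotient of two quadratics in `τ`; the two
summands are `E'' (s')²` and `E' s''` for the profile `E`. -/
lemma fderiv_fderiv_isoEnergy (hF : F ∈ GLplus 2) (H : Matrix (Fin 2) (Fin 2) ℝ)
    {s M N m n c d : ℝ} (hs : beltramiSq F = s) (hM : conformalNormSq F = M)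
    (hN : anticonformalNormSq F = N) (hm : conformalInner F H = m)
    (hn : anticonformalInner F H = n) (hc : conformalNormSq H = c)
    (hd : anticonformalNormSq H = d) :
    fderiv ℝ (fderiv ℝ (isoEnergy 2)) F H H =
      (2 * deriv artanhSeries s / (1 - s) + 2 * artanhSeries s / (1 - s) ^ 2) *
        ((2 * n * M - N * (2 * m)) / M ^ 2) ^ 2 +
      2 * artanhSeries s / (1 - s) *
        (((2 * d * M - N * (2 * c)) * M ^ 2 - (2 * n * M - N * (2 * m)) * (2 * M * (2 * m))) /
          (M ^ 2) ^ 2) := by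
  have hM0 : M ≠ 0 := hM ▸ (conformalNormSq_pos hF).ne'
  set Mt : ℝ → ℝ := fun τ => M + 2 * m * τ + c * τ ^ 2 with hMt
  set Nt : ℝ → ℝ := fun τ => N + 2 * n * τ + d * τ ^ 2 with hNt
  have hMd : ∀ τ, HasDerivAt Mt (2 * m + 2 * c * τ) τ := hasDerivAt_quadratic M m c
  have hNd : ∀ τ, HasDerivAt Nt (2 * n + 2 * d * τ) τ := hasDerivAt_quadratic N n d
  have hbel : ∀ τ : ℝ, beltramiSq (F + τ • H) = Nt τ / Mt τ := fun τ => by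
    rw [beltramiSq, conformalNormSq_add_smul, anticonformalNormSq_add_smul, hM, hN, hm, hn, hc, hd]
  have hMpos : ∀ τ : ℝ, F + τ • H ∈ GLplus 2 → Mt τ ≠ 0 := fun τ hτ => by
    have := (conformalNormSq_pos hτ).ne'
    rwa [conformalNormSq_add_smul, hM, hm, hc] at this
  have hev : ∀ᶠ τ in nhds (0 : ℝ), F + τ • H ∈ GLplus 2 := by
    have hcont : ContinuousAt (fun τ : ℝ => F + τ • H) 0 := by fun_prop
    exact hcont.preimage_mem_nhds (isOpen_GLplus.mem_nhds (by simpa using hF))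
  have hquot : ∀ τ : ℝ, F + τ • H ∈ GLplus 2 → HasDerivAt (fun τ => Nt τ / Mt τ)
      (((2 * n + 2 * d * τ) * Mt τ - Nt τ * (2 * m + 2 * c * τ)) / Mt τ ^ 2) τ :=
    fun τ hτ => (hNd τ).div (hMd τ) (hMpos τ hτ)
  have hF0 : F + (0 : ℝ) • H ∈ GLplus 2 := by simpa using hF
  have hs0 : Nt 0 / Mt 0 = s := by rw [← hbel]; simpa using hs
  have h0 : 0 ≤ s := hs ▸ beltramiSq_nonneg hF
  have h1 : s < 1 := hs ▸ beltramiSq_lt_one hF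
  refine fderiv_fderiv_apply_self
    (g := fun τ => 2 * artanhSeries (Nt τ / Mt τ) / (1 - Nt τ / Mt τ) *
      (((2 * n + 2 * d * τ) * Mt τ - Nt τ * (2 * m + 2 * c * τ)) / Mt τ ^ 2))
    (contDiffOn_isoEnergy.contDiffAt (isOpen_GLplus.mem_nhds hF)) ?_ ?_
  -- The formula for the energy holds on `GL⁺(2)` only, so differentiating at `τ` needs it on a
  -- neighbourhood of `τ`.
  · filter_upwards [hev.eventually_nhds] with τ hτ
    have hτ' : F + τ • H ∈ GLplus 2 := hτ.self_of_nhds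
    have heq : (fun τ : ℝ => isoEnergy 2 (F + τ • H)) =ᶠ[nhds τ]
        fun τ => energyProfile (Nt τ / Mt τ) := by
      filter_upwards [hτ] with σ hσ
      rw [isoEnergy_eq hσ, hbel]
    refine HasDerivAt.congr_of_eventuallyEq ?_ heq
    refine HasDerivAt.comp τ (h₂ := energyProfile) ?_ (hquot τ hτ')
    rw [← hbel]
    exact hasDerivAt_energyProfile (beltramiSq_nonneg hτ') (beltramiSq_lt_one hτ')
  · have hd1 : HasDerivAt (fun τ => 2 * artanhSeries (Nt τ / Mt τ) / (1 - Nt τ / Mt τ))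
        ((2 * deriv artanhSeries s / (1 - s) + 2 * artanhSeries s / (1 - s) ^ 2) *
          (((2 * n + 2 * d * 0) * Mt 0 - Nt 0 * (2 * m + 2 * c * 0)) / Mt 0 ^ 2)) 0 := by
      refine HasDerivAt.comp (0 : ℝ) (h₂ := fun s => 2 * artanhSeries s / (1 - s)) ?_
        (hquot 0 hF0)
      rw [hs0]
      exact hasDerivAt_deriv_energyProfile h0 h1
    have hlin : ∀ e f : ℝ, HasDerivAt (fun τ : ℝ => 2 * e + 2 * f * τ) (2 * f) 0 := fun e f => by
      simpa using ((hasDerivAt_id (0 : ℝ)).const_mul (2 * f)).const_add (2 * e)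
    have hd2 := ((((hlin n d).mul (hMd 0)).sub ((hNd 0).mul (hlin m c))).div ((hMd 0).pow 2)
      (pow_ne_zero 2 (hMpos 0 hF0)))
    refine (hd1.mul hd2).congr_deriv ?_
    have e1 : Mt 0 = M := by simp [hMt]
    have e2 : Nt 0 = N := by simp [hNt]
    simp only [Pi.mul_apply, Pi.sub_apply, Pi.div_apply, Pi.pow_apply, hs0]
    simp only [e1, e2, mul_zero, add_zero]
    norm_num
    ring

/-- Here `q` stands for `p'(r²)`. It comes with the factor `r² (x - r y)²`, so the differential
equation removes it without division by `r`, and `r = 0` is included. -/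
lemma rankOneForm_eq {p q r A k x y : ℝ} (hA : A ≠ 0) (hr : 1 - r ^ 2 ≠ 0)
    (hq : 2 * r ^ 2 * q = 1 / (1 - r ^ 2) - p) :
    (2 * q / (1 - r ^ 2) + 2 * p / (1 - r ^ 2) ^ 2) *
        ((2 * (r * A * k * x) * A ^ 2 - r ^ 2 * A ^ 2 * (2 * (A * k * y))) / (A ^ 2) ^ 2) ^ 2 +
      2 * p / (1 - r ^ 2) *
        (((2 * k ^ 2 * A ^ 2 - r ^ 2 * A ^ 2 * (2 * k ^ 2)) * (A ^ 2) ^ 2 -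
            (2 * (r * A * k * x) * A ^ 2 - r ^ 2 * A ^ 2 * (2 * (A * k * y))) *
              (2 * A ^ 2 * (2 * (A * k * y)))) / ((A ^ 2) ^ 2) ^ 2) =
    4 * k ^ 2 / (A ^ 2 * (1 - r ^ 2) ^ 2) *
      ((1 - p + 3 * p * r ^ 2) * (x - r * y) ^ 2 +
        p * (1 - r ^ 2) * ((1 - r ^ 2) - 4 * r * y * (x - r * y))) := by
  have hq' : 2 * r ^ 2 * q * (1 - r ^ 2) = 1 - p * (1 - r ^ 2) := by
    rw [hq]; field_simp
  field_simp
  linear_combination (4 * k ^ 2 * (x - r * y) ^ 2) * hq'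

/-- The second derivative of the energy in a direction with vanishing determinant, in terms of
the cosines `x`, `y` of the angles between the (anti)conformal parts. -/
lemma fderiv_fderiv_isoEnergy_eq (hF : F ∈ GLplus 2) {H : Matrix (Fin 2) (Fin 2) ℝ}
    (hH : H.det = 0) {r x y : ℝ} (hr : √(beltramiSq F) = r)
    (hx : anticonformalInner F H = √(anticonformalNormSq F) * √(conformalNormSq H) * x)
    (hy : conformalInner F H = √(conformalNormSq F) * √(conformalNormSq H) * y) :
    fderiv ℝ (fderiv ℝ (isoEnergy 2)) F H H =
      4 * conformalNormSq H / (conformalNormSq F * (1 - r ^ 2) ^ 2) *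
      ((1 - artanhSeries (r ^ 2) + 3 * artanhSeries (r ^ 2) * r ^ 2) * (x - r * y) ^ 2 +
        artanhSeries (r ^ 2) * (1 - r ^ 2) * ((1 - r ^ 2) - 4 * r * y * (x - r * y))) := by
  have h0 := beltramiSq_nonneg hF
  have h1 := beltramiSq_lt_one hF
  have hM := conformalNormSq_pos hF
  have hHc : 0 ≤ conformalNormSq H := by rw [conformalNormSq]; positivity
  have hs : beltramiSq F = r ^ 2 := by rw [← hr, Real.sq_sqrt h0]
  have hd : anticonformalNormSq H = √(conformalNormSq H) ^ 2 := by
    rw [det_eq_conformal_sub] at hH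
    rw [Real.sq_sqrt hHc]; linarith
  have hA : √(conformalNormSq F) ≠ 0 := (Real.sqrt_pos.2 hM).ne'
  have hM2 : conformalNormSq F = √(conformalNormSq F) ^ 2 := (Real.sq_sqrt hM.le).symm
  have hN2 : anticonformalNormSq F = r ^ 2 * √(conformalNormSq F) ^ 2 := by
    rw [Real.sq_sqrt hM.le, ← hs, beltramiSq]; field_simp
  have hr0 : 0 ≤ r := hr ▸ Real.sqrt_nonneg _
  have hx' : anticonformalInner F H = r * √(conformalNormSq F) * √(conformalNormSq H) * x := by
    rw [hx, hN2, ← mul_pow, Real.sqrt_sq (by positivity)]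
  rw [hs] at h0 h1
  rw [fderiv_fderiv_isoEnergy hF H hs hM2 hN2 hy hx' (Real.sq_sqrt hHc).symm hd,
    rankOneForm_eq hA (by linarith) (deriv_artanhSeries h0 h1), Real.sq_sqrt hHc,
    Real.sq_sqrt hM.le]

/-! ### The ellipticity criterion -/

lemma exists_eq_sqrt_mul_sqrt_mul {M N c : ℝ} (h : c ^ 2 ≤ M * N) (hM : 0 ≤ M) :
    ∃ x, |x| ≤ 1 ∧ c = √M * √N * x := by
  have h' : |c| ≤ √M * √N := by
    rw [← Real.sqrt_mul hM]; exact Real.abs_le_sqrt h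
  rcases (by positivity : 0 ≤ √M * √N).eq_or_lt with h0 | h0
  · refine ⟨0, by simp, ?_⟩
    rw [← h0] at h'
    simpa using h'
  · refine ⟨c / (√M * √N), ?_, by rw [mul_div_assoc', mul_div_cancel_left₀ _ h0.ne']⟩
    rwa [abs_div, abs_of_pos h0, div_le_one h0]

lemma isLHElliptic_of_le (hF : F ∈ GLplus 2)
    (h : 2 * √(beltramiSq F) * artanhSeries (beltramiSq F) ≤ 1) :
    IsLHElliptic (isoEnergy 2) F := by
  intro ξ η
  have hH : (Matrix.vecMulVec ξ η).det = 0 := by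
    simp [Matrix.det_fin_two, Matrix.vecMulVec_apply]; ring
  set H := Matrix.vecMulVec ξ η
  have hd : anticonformalNormSq H = conformalNormSq H := by
    rw [det_eq_conformal_sub] at hH; linarith
  have hM := conformalNormSq_pos hF
  obtain ⟨x, hx, hx'⟩ := exists_eq_sqrt_mul_sqrt_mul (anticonformalInner_sq_le F H)
    (anticonformalNormSq_nonneg F)
  obtain ⟨y, hy, hy'⟩ := exists_eq_sqrt_mul_sqrt_mul (conformalInner_sq_le F H) hM.le
  rw [hd] at hx'
  have h0 := beltramiSq_nonneg hF
  have h1 := beltramiSq_lt_one hF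
  rw [fderiv_fderiv_isoEnergy_eq hF hH rfl hx' hy']
  have hHc : 0 ≤ conformalNormSq H := by rw [conformalNormSq]; positivity
  refine mul_nonneg (div_nonneg (by positivity) (by positivity)) ?_
  rw [Real.sq_sqrt h0]
  have := rankOneForm_nonneg (p := artanhSeries (beltramiSq F)) (Real.sqrt_nonneg (beltramiSq F))
    (by rw [Real.sqrt_lt' one_pos]; simpa) (one_le_artanhSeries h0 h1)
    (by rw [Real.sq_sqrt h0]; exact artanhSeries_mul_le_one h0 h1) h hx hy
  rwa [Real.sq_sqrt h0] at this

/-- There is a rank-one direction whose conformal and anticonformal parts point in the directions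
of those of `F`. -/
lemma exists_rankOne_aligned (hF : F ∈ GLplus 2) (hN : 0 < anticonformalNormSq F) :
    ∃ ξ η : Fin 2 → ℝ, 0 < conformalNormSq (Matrix.vecMulVec ξ η) ∧
      anticonformalInner F (Matrix.vecMulVec ξ η) =
        √(anticonformalNormSq F) * √(conformalNormSq (Matrix.vecMulVec ξ η)) ∧
      conformalInner F (Matrix.vecMulVec ξ η) =
        √(conformalNormSq F) * √(conformalNormSq (Matrix.vecMulVec ξ η)) := by
  have hM := conformalNormSq_pos hF
  -- Take `z² = a b`, `ξ = z` and `η = ā z`. The parts of `ξ ⊗ η` are `ξ η̄ / 2 = a |z|² / 2` and `ξ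
  -- η / 2 = |a|² b / 2`, positive multiples of `a` and `b`.
  obtain ⟨z, hz⟩ := IsAlgClosed.exists_pow_nat_eq
    ((⟨(F 0 0 + F 1 1) / 2, (F 1 0 - F 0 1) / 2⟩ * ⟨(F 0 0 - F 1 1) / 2, (F 1 0 + F 0 1) / 2⟩ : ℂ))
    two_pos
  obtain ⟨u, v⟩ := z
  rw [sq, Complex.ext_iff] at hz
  simp only [Complex.mul_re, Complex.mul_im] at hz
  obtain ⟨hre, him⟩ := hz
  have hL : (u ^ 2 + v ^ 2) ^ 2 = conformalNormSq F * anticonformalNormSq F := by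
    have : (u ^ 2 + v ^ 2) ^ 2 = (u * u - v * v) ^ 2 + (u * v + v * u) ^ 2 := by ring
    rw [this, hre, him, conformalNormSq, anticonformalNormSq]
    ring
  obtain ⟨η, hη0, hη1⟩ : ∃ η : Fin 2 → ℝ,
      η 0 = (F 0 0 + F 1 1) / 2 * u + (F 1 0 - F 0 1) / 2 * v ∧
      η 1 = (F 0 0 + F 1 1) / 2 * v - (F 1 0 - F 0 1) / 2 * u := ⟨![_, _], rfl, rfl⟩
  have hα : conformalInner F (Matrix.vecMulVec ![u, v] η) =
      conformalNormSq F * (u ^ 2 + v ^ 2) / 2 := by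
    simp [conformalInner, conformalNormSq, Matrix.vecMulVec_apply, hη0, hη1]
    ring
  have hβ : anticonformalInner F (Matrix.vecMulVec ![u, v] η) =
      conformalNormSq F * anticonformalNormSq F / 2 := by
    simp [anticonformalInner, conformalNormSq, anticonformalNormSq, Matrix.vecMulVec_apply, hη0,
      hη1]
    linear_combination
      ((F 0 0 - F 1 1) / 2 * ((F 0 0 + F 1 1) / 2) - (F 1 0 + F 0 1) / 2 * ((F 1 0 - F 0 1) / 2)) / 2
        * hre +
      ((F 0 0 - F 1 1) / 2 * ((F 1 0 - F 0 1) / 2) + (F 1 0 + F 0 1) / 2 * ((F 0 0 + F 1 1) / 2)) / 2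
        * him
  have hc : conformalNormSq (Matrix.vecMulVec ![u, v] η) =
      conformalNormSq F * ((u ^ 2 + v ^ 2) / 2) ^ 2 := by
    simp [conformalNormSq, Matrix.vecMulVec_apply, hη0, hη1]
    ring
  have hc' : conformalNormSq F * ((u ^ 2 + v ^ 2) / 2) ^ 2 =
      anticonformalNormSq F * (conformalNormSq F / 2) ^ 2 := by
    rw [div_pow, hL]; ring
  refine ⟨![u, v], η, ?_, ?_, ?_⟩
  · rw [hc, hc']
    positivity
  · rw [hβ, hc, hc', Real.sqrt_mul hN.le, Real.sqrt_sq (by positivity), ← mul_assoc,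
      Real.mul_self_sqrt hN.le]
    ring
  · rw [hα, hc, Real.sqrt_mul hM.le, Real.sqrt_sq (by positivity), ← mul_assoc,
      Real.mul_self_sqrt hM.le]
    ring

lemma le_of_isLHElliptic (hF : F ∈ GLplus 2) (h : IsLHElliptic (isoEnergy 2) F) :
    2 * √(beltramiSq F) * artanhSeries (beltramiSq F) ≤ 1 := by
  rcases (anticonformalNormSq_nonneg F).eq_or_lt with hN | hN
  · simp [beltramiSq, ← hN]
  obtain ⟨ξ, η, hc, hx, hy⟩ := exists_rankOne_aligned hF hN
  have hH : (Matrix.vecMulVec ξ η).det = 0 := by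
    simp [Matrix.det_fin_two, Matrix.vecMulVec_apply]; ring
  have h0 := beltramiSq_nonneg hF
  have h1 := beltramiSq_lt_one hF
  have hM := conformalNormSq_pos hF
  have := h ξ η
  rw [fderiv_fderiv_isoEnergy_eq hF hH rfl (hx.trans (mul_one _).symm)
    (hy.trans (mul_one _).symm)] at this
  have hss := Real.sq_sqrt h0
  have hr1 : √(beltramiSq F) < 1 := by rw [Real.sqrt_lt' one_pos]; simpa
  generalize √(beltramiSq F) = r at *
  rw [hss] at this
  have hs1 : 0 < 1 - beltramiSq F := by linarith
  have h2 := nonneg_of_mul_nonneg_right this (div_pos (by positivity) (by positivity))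
  rw [← hss] at h2 ⊢
  generalize artanhSeries (r ^ 2) = p at *
  -- The form at `x = y = 1`, factored.
  have h3 : 0 ≤ (1 - r) ^ 2 * (1 - 2 * r * p) := by linarith
  have := nonneg_of_mul_nonneg_right h3 (pow_pos (sub_pos.2 hr1) 2)
  linarith

lemma isLHElliptic_isoEnergy_iff (hF : F ∈ GLplus 2) :
    IsLHElliptic (isoEnergy 2) F ↔ isoEnergy 2 F ≤ 1 / 2 := by
  have h0 := beltramiSq_nonneg hF
  have hp := one_le_artanhSeries h0 (beltramiSq_lt_one hF)
  -- The base `2 r p = 2 artanh r` is the logarithm of the larger singular value over the smaller.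
  have h : isoEnergy 2 F = (2 * √(beltramiSq F) * artanhSeries (beltramiSq F)) ^ 2 / 2 := by
    rw [isoEnergy_eq hF, energyProfile, mul_pow, mul_pow, Real.sq_sqrt h0]; ring
  have h2 : isoEnergy 2 F ≤ 1 / 2 ↔ 2 * √(beltramiSq F) * artanhSeries (beltramiSq F) ≤ 1 := by
    rw [← sq_le_one_iff₀ (by positivity), h]
    constructor <;> intro h <;> linarith
  rw [h2]
  exact ⟨le_of_isLHElliptic hF, isLHElliptic_of_le hF⟩

end Hencky

theorem proposition3p1 :
    -- the energy is of class `C²` on `GL⁺(2)`, so that its second derivative is meaningful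
    ContDiffOn ℝ 2 (Hencky.isoEnergy 2) (Hencky.GLplus 2) ∧
    Hencky.maximalEllipticityDomain (Hencky.isoEnergy 2) =
      {F | F ∈ Hencky.GLplus 2 ∧ Hencky.rightStretch F ∈ Hencky.stretchDomain 2 (1 / 2)} ∧
    Hencky.maximalEllipticityDomain (Hencky.isoEnergy 2) =
      {F | F ∈ Hencky.GLplus 2 ∧
        (Real.log (Hencky.singVal F 0 / Hencky.singVal F 1)) ^ 2 ≤ 1} := by
  refine ⟨Hencky.contDiffOn_isoEnergy, ?_, ?_⟩
  · ext F
    refine and_congr_right fun hF => ?_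
    rw [Hencky.isLHElliptic_isoEnergy_iff hF]
    exact ⟨fun h => ⟨Hencky.rightStretch_mem_PSym hF, h⟩, fun h => h.2⟩
  · ext F
    refine and_congr_right fun hF => ?_
    rw [Hencky.isLHElliptic_isoEnergy_iff hF, Hencky.log_singVal_div_sq hF]
    constructor <;> intro h <;> linarith
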